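/- Let $G$ be a finite simple graph with adjacency matrix $A$, and let $i\neq j$ be vertices of $G$. Perfect state transfer occurs between $i$ and $j$ at time $s>0$ if $\exp(\mathrm{i}sA)e_i=\lambda e_j$ for some $\lambda\in\mathbb{C}$ with $|\lambda|=1$, where $e_v$ is the characteristic vector of the vertex $v$. For real $\theta$ let $E_\theta$ be the orthogonal projection onto the $\theta$-eigenspace of $A$, let the support of $i$ be the set of eigenvalues $\theta$ with $(E_\theta)_{i,i}\neq 0$, and let $\theta_0$ be its largest element. Say that positive integers $\Delta$ (square-free, possibly $1$) and $g$ are *parameters of the pair* $(i,j)$ if (a) for every $\theta$ there is $\sigma_\theta\in\{-1,+1\}$ with $E_\theta e_i=\sigma_\theta E_\theta e_j$; (b) there is an integer $a$, and for every $\theta$ in the support of $i$ an integer $b_\theta$, such that $\theta=\frac{a+b_\theta\sqrt{\Delta}}{2}$; (c) with these signs and integers, for every $\theta$ in the support of $i$, $k_\theta:=\frac{b_{\theta_0}-b_\theta}{2g}$, that is $\frac{\theta_0-\theta}{g\sqrt{\Delta}}$, is an integer with $k_\theta\equiv(1-\sigma_\theta)/2\pmod 2$. **Theorem.** Assume that perfect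 state transfer occurs between $i$ and $j$ at some positive time. Then there is a minimum positive time $t$ at which it occurs, and $t\le \pi/\sqrt{2}$. Moreover, $t=\pi/(g\sqrt{\Delta})$ for some parameters $\Delta,g$ of the pair $(i,j)$, and all parameters $\Delta,g$ of the pair satisfy $g\ge 2$ or $\Delta\ge 2$. (In particular the minimum time is never $\pi$.) -/

import Mathlib

noncomputable section

/-- Perfect state transfer from `i` to `j` at time `t` in the continuous-time quantum walk on `G`:
`exp(i t A) e_i = c e_j` for some complex number `c` of modulus one, where `A` is the adjacency
matrix of `G` and `e_v` is the characteristic vector of the vertex `v`. -/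
def PerfectStateTransfer {V : Type*} [Fintype V] [DecidableEq V] (G : SimpleGraph V)
    [DecidableRel G.Adj] (i j : V) (t : ℝ) : Prop :=
  ∃ c : ℂ, ‖c‖ = 1 ∧
    Matrix.mulVec (NormedSpace.exp ((Complex.I * (t : ℂ)) • G.adjMatrix ℂ)) (Pi.single i 1) =
      c • (Pi.single j 1 : V → ℂ)

/-- The orthogonal projection `E_θ` of `ℝ^V` onto the `θ`-eigenspace of the adjacency matrix of `G`
(it is zero if `θ` is not an eigenvalue). -/
def eigenprojection {V : Type*} [Fintype V] [DecidableEq V] (G : SimpleGraph V)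
    [DecidableRel G.Adj] (θ : ℝ) : EuclideanSpace ℝ V →L[ℝ] EuclideanSpace ℝ V :=
  (Module.End.eigenspace (Matrix.toEuclideanLin (G.adjMatrix ℝ)) θ).starProjection

/-- The eigenvalue support of the vertex `i`: the eigenvalues `θ` of `G` with `(E_θ)_{i,i} ≠ 0`. -/
def eigenvalueSupport {V : Type*} [Fintype V] [DecidableEq V] (G : SimpleGraph V)
    [DecidableRel G.Adj] (i : V) : Set ℝ :=
  {θ | eigenprojection G θ (EuclideanSpace.single i 1) i ≠ 0}

/-- `Δ` and `g` are parameters as in the spectral characterization of perfect state transfer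
between `i` and `j`. The functions `σ` and `b` give the signs `σ_θ` and the integers `b_θ`;
`θ₀` is the largest eigenvalue in the support of `i`. -/
def IsTransferParameters {V : Type*} [Fintype V] [DecidableEq V] (G : SimpleGraph V)
    [DecidableRel G.Adj] (i j : V) (Δ g : ℕ) : Prop :=
  Squarefree Δ ∧ 0 < g ∧
  ∃ (a : ℤ) (b σ : ℝ → ℤ) (θ₀ : ℝ),
    IsGreatest (eigenvalueSupport G i) θ₀ ∧
    (∀ θ : ℝ, (σ θ = 1 ∨ σ θ = -1) ∧
      eigenprojection G θ (EuclideanSpace.single i 1) =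
        (σ θ : ℝ) • eigenprojection G θ (EuclideanSpace.single j 1)) ∧
    (∀ θ ∈ eigenvalueSupport G i, θ = ((a : ℝ) + (b θ : ℝ) * √(Δ : ℝ)) / 2) ∧
    (∀ θ ∈ eigenvalueSupport G i, ∃ k : ℤ,
      b θ₀ - b θ = 2 * (g : ℤ) * k ∧ k ≡ (1 - σ θ) / 2 [ZMOD 2])

end

/-! Pairing with real eigenvectors turns state transfer at time `s` into `exp(isθ) u i = c * u j`
for every `θ`-eigenvector `u`. Taking norms gives signs `σ θ` with `u i = σ θ * u j`, and then
`exp(isθ) σ θ = c` on the support. The top sign is `+1`, because powers of a nonnegative shift of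
`A` are dominated by `E_{θ₀}`. Hence `s(θ₀ - θ)` is an integer multiple of `π` whose parity records
`σ θ` (`exists_phase`).

So the differences `θ₀ - θ` are commensurable. The polynomial with the support as simple roots is
rational, and its first two power sums force the common unit `π / s` to have rational square. As the
eigenvalues are algebraic integers, they have the form `(a + b√Δ)/2`, with differences `n√Δ`. With
`g` the gcd of the `n`, every transfer time is a multiple of `π/(g√Δ)`. The given time is an odd
multiple, so transfer already happens at `π/(g√Δ)`.

If `g = Δ = 1`, the support consists of integers whose parity separates the two signs. Integer
polynomials `P 1` and `P (-1)`, with roots in the two classes, kill `e_i + e_j` and `e_i - e_j`.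
Modulo 2 these vectors coincide while the polynomials are coprime, so `e_i + e_j = 0` over `ZMod 2`,
which is absurd (`false_of_sign_eq_parity`). Hence `g√Δ ≥ √2`. -/

open Matrix

/-! ### Real eigenvectors as test vectors, and the matrix exponential. -/

/-- A vector orthogonal to all eigenvectors of a symmetric real matrix is zero. -/
theorem Matrix.IsSymm.eq_zero_of_forall_eigenvector {V : Type*} [Fintype V] [DecidableEq V]
    {A : Matrix V V ℝ} (hA : A.IsSymm) {w : V → ℝ}
    (h : ∀ (θ : ℝ) (u : V → ℝ), A *ᵥ u = θ • u → u ⬝ᵥ w = 0) : w = 0 := by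
  have hH : A.IsHermitian := by
    rw [IsHermitian, conjTranspose_eq_transpose_of_trivial]; exact hA
  have h0 : ∀ k, hH.eigenvectorBasis.repr (WithLp.toLp 2 w) k = 0 := by
    intro k
    rw [OrthonormalBasis.repr_apply_apply, EuclideanSpace.inner_eq_star_dotProduct]
    rw [dotProduct_comm]
    exact h _ _ (hH.mulVec_eigenvectorBasis k)
  have h1 := hH.eigenvectorBasis.sum_repr (WithLp.toLp 2 w)
  simp only [h0, zero_smul, Finset.sum_const_zero] at h1
  exact (congrArg WithLp.ofLp h1).symm

/-- A complex vector orthogonal to all real eigenvectors of a symmetric real matrix is zero. -/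
theorem Matrix.IsSymm.eq_zero_of_forall_eigenvector_complex {V : Type*} [Fintype V] [DecidableEq V]
    {A : Matrix V V ℝ} (hA : A.IsSymm) {w : V → ℂ}
    (h : ∀ (θ : ℝ) (u : V → ℝ), A *ᵥ u = θ • u → (fun v => (u v : ℂ)) ⬝ᵥ w = 0) : w = 0 := by
  have hre : (fun v => (w v).re) = 0 := hA.eq_zero_of_forall_eigenvector fun θ u hu => by
    simpa [dotProduct] using congrArg Complex.re (h θ u hu)
  have him : (fun v => (w v).im) = 0 := hA.eq_zero_of_forall_eigenvector fun θ u hu => by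
    simpa [dotProduct] using congrArg Complex.im (h θ u hu)
  funext v
  exact Complex.ext (congrFun hre v) (congrFun him v)

theorem Matrix.vecMul_pow_of_eigenvector {V R : Type*} [Fintype V] [DecidableEq V] [CommRing R]
    {M : Matrix V V R} {u : V → R} {μ : R} (h : u ᵥ* M = μ • u) (n : ℕ) :
    u ᵥ* M ^ n = μ ^ n • u := by
  induction n with
  | zero => simp
  | succ n ih => rw [pow_succ, ← vecMul_vecMul, ih, smul_vecMul, h, smul_smul, pow_succ]

theorem Matrix.vecMul_exp_of_eigenvector {V : Type*} [Fintype V] [DecidableEq V]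
    {M : Matrix V V ℂ} {u : V → ℂ} {μ : ℂ} (h : u ᵥ* M = μ • u) :
    u ᵥ* NormedSpace.exp M = Complex.exp μ • u := by
  -- The norm only serves to sum the exponential series.
  let _ : NormedRing (Matrix V V ℂ) := Matrix.linftyOpNormedRing
  let _ : NormedAlgebra ℂ (Matrix V V ℂ) := Matrix.linftyOpNormedAlgebra
  have h1 : HasSum (fun n : ℕ => ((n.factorial : ℂ)⁻¹) • M ^ n) (NormedSpace.exp M) :=
    NormedSpace.exp_series_hasSum_exp' M
  have h2 : HasSum (fun n : ℕ => ((n.factorial : ℂ)⁻¹) • μ ^ n) (Complex.exp μ) := by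
    rw [Complex.exp_eq_exp_ℂ]; exact NormedSpace.exp_series_hasSum_exp' μ
  let f : Matrix V V ℂ →ₗ[ℂ] (V → ℂ) :=
    { toFun := fun N => u ᵥ* N
      map_add' := fun N N' => vecMul_add _ _ _
      map_smul' := fun c N => vecMul_smul _ _ _ }
  have hf : Continuous f := by
    change Continuous fun N : Matrix V V ℂ => u ᵥ* N
    fun_prop
  have h3 := h1.map f hf
  have h4 := h2.smul_const u
  refine h3.unique ?_
  convert h4 using 2 with n
  change u ᵥ* (((n.factorial : ℂ)⁻¹) • M ^ n) = _
  rw [vecMul_smul, vecMul_pow_of_eigenvector h, smul_smul, smul_eq_mul]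

/-! ### State transfer, eigenprojections and support in terms of eigenvectors. -/

section Graph

variable {V : Type*} [Fintype V] [DecidableEq V] (G : SimpleGraph V) [DecidableRel G.Adj]

theorem vecMul_complex_adjMatrix {θ : ℝ} {u : V → ℝ} (hu : G.adjMatrix ℝ *ᵥ u = θ • u) (t : ℝ) :
    (fun v => (u v : ℂ)) ᵥ* ((Complex.I * (t : ℂ)) • G.adjMatrix ℂ) =
      (Complex.I * t * θ) • fun v => (u v : ℂ) := by
  have h : (fun v => (u v : ℂ)) ᵥ* G.adjMatrix ℂ = (θ : ℂ) • fun v => (u v : ℂ) := by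
    funext v
    have := congrFun hu v
    simp only [SimpleGraph.adjMatrix_mulVec_apply, SimpleGraph.adjMatrix_vecMul_apply,
      Pi.smul_apply, smul_eq_mul] at this ⊢
    exact_mod_cast this
  rw [vecMul_smul, h, smul_smul]

/-- Perfect state transfer, tested on real eigenvectors. -/
theorem perfectStateTransfer_iff {i j : V} {t : ℝ} :
    PerfectStateTransfer G i j t ↔ ∃ c : ℂ, ‖c‖ = 1 ∧ ∀ (θ : ℝ) (u : V → ℝ),
      G.adjMatrix ℝ *ᵥ u = θ • u → Complex.exp (Complex.I * t * θ) * u i = c * u j := by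
  have key : ∀ (θ : ℝ) (u : V → ℝ), G.adjMatrix ℝ *ᵥ u = θ • u →
      (fun v => (u v : ℂ)) ⬝ᵥ (NormedSpace.exp ((Complex.I * (t : ℂ)) • G.adjMatrix ℂ) *ᵥ
        Pi.single i 1) = Complex.exp (Complex.I * t * θ) * u i := by
    intro θ u hu
    rw [dotProduct_mulVec, vecMul_exp_of_eigenvector (vecMul_complex_adjMatrix G hu t)]
    simp
  refine exists_congr fun c => and_congr_right fun _ => ⟨fun h θ u hu => ?_, fun h => ?_⟩
  · rw [← key θ u hu, h]; simp
  · rw [← sub_eq_zero]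
    refine (show (G.adjMatrix ℝ).IsSymm from G.isSymm_adjMatrix).eq_zero_of_forall_eigenvector_complex fun θ u hu => ?_
    rw [dotProduct_sub, key θ u hu, h θ u hu]; simp

theorem mem_eigenspace_adjMatrix {θ : ℝ} {u : EuclideanSpace ℝ V} :
    u ∈ Module.End.eigenspace (Matrix.toEuclideanLin (G.adjMatrix ℝ)) θ ↔
      G.adjMatrix ℝ *ᵥ u.ofLp = θ • u.ofLp := by
  rw [Module.End.mem_eigenspace_iff]
  constructor
  · intro h; exact congrArg WithLp.ofLp h
  · intro h; exact congrArg (WithLp.toLp 2) h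

theorem inner_eigenprojection_single {θ : ℝ} {u : V → ℝ} (hu : G.adjMatrix ℝ *ᵥ u = θ • u)
    (i : V) : inner ℝ (WithLp.toLp 2 u) (eigenprojection G θ (EuclideanSpace.single i 1)) = u i := by
  have hm : WithLp.toLp 2 u ∈ Module.End.eigenspace (Matrix.toEuclideanLin (G.adjMatrix ℝ)) θ :=
    (mem_eigenspace_adjMatrix G).2 hu
  rw [eigenprojection, ← Submodule.inner_starProjection_left_eq_right,
    Submodule.starProjection_eq_self_iff.2 hm]
  simp [EuclideanSpace.inner_single_right]

theorem eigenprojection_eigenvector (θ : ℝ) (x : EuclideanSpace ℝ V) :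
    G.adjMatrix ℝ *ᵥ (eigenprojection G θ x).ofLp = θ • (eigenprojection G θ x).ofLp :=
  (mem_eigenspace_adjMatrix G).1 (Submodule.starProjection_apply_mem _ _)

/-- The difference of the two sides lies in the eigenspace, so it vanishes once it is orthogonal to
itself. This lets the rest of the argument use entries of eigenvectors instead of projections. -/
theorem eigenprojection_single_eq_iff {θ σ : ℝ} {i j : V} :
    eigenprojection G θ (EuclideanSpace.single i 1) =
      σ • eigenprojection G θ (EuclideanSpace.single j 1) ↔
    ∀ u : V → ℝ, G.adjMatrix ℝ *ᵥ u = θ • u → u i = σ * u j := by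
  constructor
  · intro h u hu
    rw [← inner_eigenprojection_single G hu i, h, inner_smul_right,
      inner_eigenprojection_single G hu j]
  · intro h
    set d := eigenprojection G θ (EuclideanSpace.single i 1) -
      σ • eigenprojection G θ (EuclideanSpace.single j 1) with hd
    have hdm : G.adjMatrix ℝ *ᵥ d.ofLp = θ • d.ofLp := by
      rw [← mem_eigenspace_adjMatrix]
      exact Submodule.sub_mem _ (Submodule.starProjection_apply_mem _ _)
        (Submodule.smul_mem _ _ (Submodule.starProjection_apply_mem _ _))
    have h0 : inner ℝ d d = 0 := by
      conv_lhs => arg 3; rw [hd]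
      have h1 := inner_eigenprojection_single G hdm i
      have h2 := inner_eigenprojection_single G hdm j
      rw [WithLp.toLp_ofLp] at h1 h2
      rw [inner_sub_right, inner_smul_right, h1, h2, h _ hdm, sub_self]
    exact sub_eq_zero.1 (inner_self_eq_zero.1 h0)

theorem mem_eigenvalueSupport_iff {i : V} {θ : ℝ} :
    θ ∈ eigenvalueSupport G i ↔ ∃ u : V → ℝ, G.adjMatrix ℝ *ᵥ u = θ • u ∧ u i ≠ 0 := by
  constructor
  · intro h
    exact ⟨_, eigenprojection_eigenvector G θ _, h⟩
  · rintro ⟨u, hu, hi⟩ h0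
    have h1 := inner_eigenprojection_single G
      (eigenprojection_eigenvector G θ (EuclideanSpace.single i 1)) i
    rw [WithLp.toLp_ofLp, h0, inner_self_eq_zero] at h1
    have h2 := inner_eigenprojection_single G hu i
    rw [h1, inner_zero_right] at h2
    exact hi h2.symm

end Graph

/-! ### Rationality of the polynomial of the support. -/

theorem Matrix.aeval_mulVec_of_eigenvector {V : Type*} [Fintype V] [DecidableEq V]
    {A : Matrix V V ℝ} {u : V → ℝ} {θ : ℝ} (h : A *ᵥ u = θ • u) (p : Polynomial ℝ) :
    Polynomial.aeval A p *ᵥ u = p.eval θ • u := by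
  induction p using Polynomial.induction_on' with
  | add p q hp hq => rw [map_add, add_mulVec, hp, hq, Polynomial.eval_add, add_smul]
  | monomial n a =>
    have hn : A ^ n *ᵥ u = θ ^ n • u := by
      induction n with
      | zero => simp
      | succ n ih => rw [pow_succ, ← mulVec_mulVec, h, mulVec_smul, ih, smul_smul, pow_succ']
    rw [Polynomial.aeval_monomial, Polynomial.eval_monomial, ← Algebra.smul_def, smul_mulVec, hn, smul_smul]

theorem Matrix.IsSymm.dotProduct_aeval_mulVec {V : Type*} [Fintype V] [DecidableEq V]
    {A : Matrix V V ℝ} (hA : A.IsSymm) {u : V → ℝ} {θ : ℝ} (h : A *ᵥ u = θ • u)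
    (p : Polynomial ℝ) (x : V → ℝ) :
    u ⬝ᵥ (Polynomial.aeval A p *ᵥ x) = p.eval θ * (u ⬝ᵥ x) := by
  have hp : (Polynomial.aeval A p)ᵀ = Polynomial.aeval A p := by
    have hA' : Aᵀ = A := hA
    induction p using Polynomial.induction_on' with
    | add p q hp hq => rw [map_add, transpose_add, hp, hq]
    | monomial n a =>
      rw [Polynomial.aeval_monomial, ← Algebra.smul_def, transpose_smul, transpose_pow, hA']
  rw [dotProduct_mulVec, ← mulVec_transpose, hp, aeval_mulVec_of_eigenvector h, smul_dotProduct,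
    smul_eq_mul]

section Graph

variable {V : Type*} [Fintype V] [DecidableEq V] (G : SimpleGraph V) [DecidableRel G.Adj]

theorem adjMatrix_map {R S : Type*} [CommRing R] [CommRing S] (f : R →+* S) :
    f.mapMatrix (G.adjMatrix R) = G.adjMatrix S := by
  ext v w
  by_cases h : G.Adj v w <;> simp [h]

theorem eval_charpoly_adjMatrix_eq_zero {i : V} {θ : ℝ} (h : θ ∈ eigenvalueSupport G i) :
    (G.adjMatrix ℝ).charpoly.eval θ = 0 := by
  obtain ⟨u, hu, hi⟩ := (mem_eigenvalueSupport_iff G).1 h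
  have h1 := aeval_mulVec_of_eigenvector hu (G.adjMatrix ℝ).charpoly
  rw [aeval_self_charpoly, zero_mulVec] at h1
  have h2 := congrFun h1 i
  simp only [Pi.zero_apply, Pi.smul_apply, smul_eq_mul] at h2
  exact (mul_eq_zero.1 h2.symm).resolve_right hi

theorem finite_eigenvalueSupport (i : V) : (eigenvalueSupport G i).Finite := by
  refine ((G.adjMatrix ℝ).charpoly.roots.toFinset.finite_toSet).subset fun θ h => ?_
  rw [Finset.mem_coe, Multiset.mem_toFinset, Polynomial.mem_roots (charpoly_monic _).ne_zero]
  exact eval_charpoly_adjMatrix_eq_zero G h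

theorem isIntegral_of_mem_eigenvalueSupport {i : V} {θ : ℝ} (h : θ ∈ eigenvalueSupport G i) :
    IsIntegral ℤ θ := by
  refine ⟨(G.adjMatrix ℤ).charpoly, charpoly_monic _, ?_⟩
  rw [← eval_charpoly_adjMatrix_eq_zero G h, ← adjMatrix_map G (algebraMap ℤ ℝ),
    RingHom.mapMatrix_apply, charpoly_map, Polynomial.eval_map]

/-- Polynomials annihilating the characteristic vector of `i` vanish on the support of `i`, and
conversely. -/
theorem aeval_adjMatrix_mulVec_single_eq_zero_iff {i : V} (p : Polynomial ℝ) :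
    Polynomial.aeval (G.adjMatrix ℝ) p *ᵥ Pi.single i 1 = 0 ↔
      ∀ θ ∈ eigenvalueSupport G i, p.eval θ = 0 := by
  have hs : (G.adjMatrix ℝ).IsSymm := G.isSymm_adjMatrix
  constructor
  · intro h θ hθ
    obtain ⟨u, hu, hi⟩ := (mem_eigenvalueSupport_iff G).1 hθ
    have h1 := hs.dotProduct_aeval_mulVec hu p (Pi.single i 1)
    rw [h, dotProduct_zero, dotProduct_single, mul_one] at h1
    exact (mul_eq_zero.1 h1.symm).resolve_right hi
  · intro h
    refine hs.eq_zero_of_forall_eigenvector fun θ u hu => ?_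
    rw [hs.dotProduct_aeval_mulVec hu, dotProduct_single, mul_one]
    by_cases hi : u i = 0
    · rw [hi, mul_zero]
    · rw [h θ ((mem_eigenvalueSupport_iff G).2 ⟨u, hu, hi⟩), zero_mul]

/-- The product is the monic polynomial of least degree killing `e_i` under `A`. Since `A` and `e_i`
are rational, applying a `ℚ`-linear retraction `ℝ → ℚ` to its coefficients gives a rational monic
polynomial of the same degree that also kills `e_i`; divisibility makes the two equal. -/
theorem exists_rat_polynomial_of_eigenvalueSupport (i : V) :
    ∃ p : Polynomial ℚ, p.map (algebraMap ℚ ℝ) =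
      ∏ θ ∈ (finite_eigenvalueSupport G i).toFinset, (Polynomial.X - Polynomial.C θ) := by
  classical
  set S := (finite_eigenvalueSupport G i).toFinset with hS
  set ψ : Polynomial ℝ := ∏ θ ∈ S, (Polynomial.X - Polynomial.C θ) with hψ
  have hmon : ψ.Monic := Polynomial.monic_prod_of_monic _ _ fun θ _ => Polynomial.monic_X_sub_C θ
  obtain ⟨φ, hφ⟩ := LinearMap.exists_leftInverse_of_injective (Algebra.linearMap ℚ ℝ)
    (LinearMap.ker_eq_bot.2 (algebraMap ℚ ℝ).injective)
  have hφ1 : ∀ q : ℚ, φ q = q := fun q => LinearMap.congr_fun hφ q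
  have hφm : ∀ (c : ℝ) (q : ℚ), φ (c * q) = φ c * q := fun c q => by
    have := φ.map_smul q c
    rw [mul_comm c, mul_comm (φ c), ← smul_eq_mul (q), ← this, Rat.smul_def]
  have hentry : ∀ (n : ℕ) (v w : V), (G.adjMatrix ℝ ^ n) v w =
      (((G.adjMatrix ℚ ^ n) v w : ℚ) : ℝ) := fun n v w => by
    rw [← adjMatrix_map G (algebraMap ℚ ℝ), ← map_pow]; rfl
  have hval : ∀ (f : Polynomial ℝ) (N : ℕ), f.natDegree < N → ∀ v,
      (Polynomial.aeval (G.adjMatrix ℝ) f *ᵥ Pi.single i 1) v =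
        ∑ n ∈ Finset.range N, f.coeff n * (((G.adjMatrix ℚ ^ n) v i : ℚ) : ℝ) := by
    intro f N hN v
    rw [Polynomial.aeval_eq_sum_range' hN, mulVec_single_one, col_apply, Matrix.sum_apply]
    exact Finset.sum_congr rfl fun n _ => by rw [Matrix.smul_apply, hentry, smul_eq_mul]
  let p : Polynomial ℚ := ∑ n ∈ Finset.range (ψ.natDegree + 1), Polynomial.monomial n (φ (ψ.coeff n))
  have hpc : ∀ n, p.coeff n = φ (ψ.coeff n) := by
    intro n
    simp only [p, Polynomial.finsetSum_coeff, Polynomial.coeff_monomial, Finset.sum_ite_eq',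
      Finset.mem_range]
    split_ifs with h
    · rfl
    · rw [Polynomial.coeff_eq_zero_of_natDegree_lt (by omega), map_zero]
  have hpdeg : p.natDegree ≤ ψ.natDegree := by
    rw [Polynomial.natDegree_le_iff_coeff_eq_zero]
    intro n hn
    rw [hpc, Polynomial.coeff_eq_zero_of_natDegree_lt hn, map_zero]
  have hpmon : (p.map (algebraMap ℚ ℝ)).Monic := by
    refine Polynomial.Monic.map _ (Polynomial.monic_of_natDegree_le_of_coeff_eq_one _ hpdeg ?_)
    rw [hpc, hmon.coeff_natDegree]; exact_mod_cast hφ1 1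
  refine ⟨p, Polynomial.eq_of_monic_of_dvd_of_natDegree_le hmon hpmon ?_
    (Polynomial.natDegree_map_le.trans hpdeg)⟩
  have hψ0 : Polynomial.aeval (G.adjMatrix ℝ) ψ *ᵥ Pi.single i 1 = 0 := by
    rw [aeval_adjMatrix_mulVec_single_eq_zero_iff]
    intro θ hθ
    rw [hψ, Polynomial.eval_prod]
    exact Finset.prod_eq_zero (by simpa [hS] using hθ) (by simp)
  have hp0 : Polynomial.aeval (G.adjMatrix ℝ) (p.map (algebraMap ℚ ℝ)) *ᵥ Pi.single i 1 = 0 := by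
    funext v
    have h1 := congrFun hψ0 v
    rw [hval _ _ (Nat.lt_succ_self _)] at h1
    have h2 := congrArg φ h1
    rw [Pi.zero_apply, map_zero, map_sum] at h2
    simp only [hφm] at h2
    rw [hval _ (ψ.natDegree + 1) (Nat.lt_succ_of_le (Polynomial.natDegree_map_le.trans hpdeg))]
    simp only [Polynomial.coeff_map, hpc]
    have h3 := congrArg (algebraMap ℚ ℝ) h2
    rw [map_sum, map_zero] at h3
    simp only [map_mul] at h3
    exact h3
  rw [aeval_adjMatrix_mulVec_single_eq_zero_iff] at hp0
  refine Finset.prod_dvd_of_coprime ?_ fun θ hθ => ?_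
  · intro θ _ θ' _ hne
    exact Polynomial.isCoprime_X_sub_C_of_isUnit_sub (sub_ne_zero.2 hne).isUnit
  · rw [Polynomial.dvd_iff_isRoot]
    exact hp0 θ (by simpa [hS] using hθ)

end Graph

/-! ### Power sums, quadratic integers and commensurable spectra. -/

/-- The first two power sums of the roots of a split monic rational polynomial are rational. -/
theorem Polynomial.exists_rat_power_sums {S : Finset ℝ} {p : Polynomial ℚ}
    (hp : p.map (algebraMap ℚ ℝ) = ∏ θ ∈ S, (Polynomial.X - Polynomial.C θ)) :
    (∃ q : ℚ, ∑ θ ∈ S, θ = q) ∧ ∃ q : ℚ, ∑ θ ∈ S, θ ^ 2 = q := by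
  classical
  -- Reversal moves the two leading nontrivial coefficients to degrees 1 and 2, where they are easy
  -- to track by induction.
  have hrev : (p.map (algebraMap ℚ ℝ)).reverse = ∏ θ ∈ S, (1 - Polynomial.C θ * Polynomial.X) := by
    rw [hp]
    clear hp
    induction S using Finset.induction_on with
    | empty => simp [← Polynomial.C_1, -map_one]
    | insert a s ha ih =>
      rw [Finset.prod_insert ha, Finset.prod_insert ha, Polynomial.reverse_mul_of_domain, ih]
      congr 1
      rw [Polynomial.reverse, Polynomial.natDegree_X_sub_C, Polynomial.reflect_sub,
        Polynomial.reflect_C, pow_one]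
      congr 1
      simp
  have hcoeff : ∀ T : Finset ℝ, (∏ θ ∈ T, (1 - Polynomial.C θ * Polynomial.X)).coeff 0 = 1 ∧
      (∏ θ ∈ T, (1 - Polynomial.C θ * Polynomial.X)).coeff 1 = - ∑ θ ∈ T, θ ∧
      2 * (∏ θ ∈ T, (1 - Polynomial.C θ * Polynomial.X)).coeff 2 =
        (∑ θ ∈ T, θ) ^ 2 - ∑ θ ∈ T, θ ^ 2 := by
    intro T
    induction T using Finset.induction_on with
    | empty => simp [Polynomial.coeff_one]
    | insert a s ha ih =>
      obtain ⟨h0, h1, h2⟩ := ih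
      simp only [Finset.prod_insert ha, Finset.sum_insert ha, sub_mul, one_mul, mul_assoc,
        Polynomial.coeff_sub, Polynomial.coeff_C_mul, Polynomial.coeff_X_mul_zero, h0]
      have e1 := Polynomial.coeff_X_mul (∏ θ ∈ s, (1 - Polynomial.C θ * Polynomial.X)) 0
      have e2 := Polynomial.coeff_X_mul (∏ θ ∈ s, (1 - Polynomial.C θ * Polynomial.X)) 1
      rw [zero_add] at e1
      rw [one_add_one_eq_two] at e2
      rw [e1, e2, h0, h1]
      refine ⟨by ring, by ring, ?_⟩
      linear_combination h2
  have hrat : ∀ n, ∃ q : ℚ, (∏ θ ∈ S, (1 - Polynomial.C (θ : ℝ) * Polynomial.X)).coeff n = (q : ℝ) :=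
    fun n => ⟨p.reverse.coeff n, by
      rw [← hrev, Polynomial.reverse, Polynomial.natDegree_map, Polynomial.reflect_map,
        Polynomial.coeff_map, Polynomial.reverse, eq_ratCast]⟩
  obtain ⟨_, h1, h2⟩ := hcoeff S
  obtain ⟨q1, hq1⟩ := hrat 1
  obtain ⟨q2, hq2⟩ := hrat 2
  refine ⟨⟨-q1, ?_⟩, ⟨q1 ^ 2 - 2 * q2, ?_⟩⟩
  · push_cast; linarith
  · rw [hq2, ← neg_sq, ← h1, hq1] at h2
    push_cast; linarith

theorem Squarefree.exists_int_of_sq_mul_eq {Δ : ℕ} (hΔ : Squarefree Δ) {x : ℚ} {N : ℤ}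
    (h : x ^ 2 * Δ = N) : ∃ n : ℤ, x = n := by
  have hd : (x.den : ℚ) ≠ 0 := by exact_mod_cast x.den_nz
  have h1 : (x.num : ℚ) ^ 2 * Δ = N * (x.den : ℚ) ^ 2 := by
    rw [← h]; nth_rewrite 2 [← Rat.num_div_den x]; field_simp
  have h2 : x.num ^ 2 * Δ = N * (x.den : ℤ) ^ 2 := by exact_mod_cast h1
  have h3 : (x.den : ℤ) ^ 2 ∣ Δ := by
    have hc : IsCoprime ((x.den : ℤ) ^ 2) (x.num ^ 2) :=
      (Int.isCoprime_iff_gcd_eq_one.2 (by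
        rw [Int.gcd_comm]; exact x.reduced)).pow
    exact hc.dvd_of_dvd_mul_left (h2 ▸ Dvd.intro_left N rfl)
  have h4 : x.den * x.den ∣ Δ := by rw [← sq]; exact_mod_cast h3
  have h5 : x.den = 1 := Nat.isUnit_iff.1 (hΔ _ h4)
  exact ⟨x.num, ((Rat.den_eq_one_iff x).1 h5).symm⟩

theorem Rat.exists_int_of_isIntegral_real {q : ℚ} (h : IsIntegral ℤ (q : ℝ)) :
    ∃ n : ℤ, q = n := by
  have h1 : IsIntegral ℤ q :=
    (isIntegral_algebraMap_iff (A := ℚ) (B := ℝ) (algebraMap ℚ ℝ).injective).1 h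
  obtain ⟨n, hn⟩ := IsIntegrallyClosed.isIntegral_iff.1 h1
  exact ⟨n, hn.symm⟩

theorem Squarefree.irrational_sqrt {Δ : ℕ} (hΔ : Squarefree Δ) (h2 : 2 ≤ Δ) :
    Irrational √(Δ : ℝ) := by
  rw [irrational_sqrt_natCast_iff]
  rintro ⟨k, hk⟩
  have : k = 1 := Nat.isUnit_iff.1 (hΔ k ⟨1, by rw [mul_one, hk]⟩)
  subst this; omega

/-- The trace of a quadratic integer is an integer. -/
theorem Squarefree.exists_int_of_isIntegral_add_mul_sqrt {Δ : ℕ} (hΔ : Squarefree Δ) (h2 : 2 ≤ Δ)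
    {q r : ℚ} (hr : r ≠ 0) (h : IsIntegral ℤ ((q : ℝ) + r * √(Δ : ℝ))) : ∃ a : ℤ, 2 * q = a := by
  set x : ℝ := (q : ℝ) + r * √(Δ : ℝ) with hx
  have hirr : Irrational x := ((hΔ.irrational_sqrt h2).ratCast_mul hr).ratCast_add q
  have hQ : IsIntegral ℚ x := h.tower_top
  let f : Polynomial ℚ := Polynomial.X ^ 2 + (Polynomial.C (-(2 * q)) * Polynomial.X +
    Polynomial.C (q ^ 2 - r ^ 2 * Δ))
  have hfd : f.natDegree = 2 := by
    simp only [f]; compute_degree!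
  have hfm : f.Monic := by
    simp only [f]; monicity!
  have hf0 : Polynomial.aeval x f = 0 := by
    have hs : √(Δ : ℝ) ^ 2 = Δ := Real.sq_sqrt (Nat.cast_nonneg _)
    simp only [f, map_add, map_mul, map_pow, Polynomial.aeval_X, Polynomial.aeval_C, hx,
      eq_ratCast]
    push_cast
    linear_combination (r : ℝ) ^ 2 * hs
  have heq : f = minpoly ℚ x := by
    refine Polynomial.eq_of_monic_of_dvd_of_natDegree_le (minpoly.monic hQ) hfm
      (minpoly.dvd ℚ x hf0) ?_
    rw [hfd, minpoly.two_le_natDegree_iff hQ]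
    rintro ⟨y, hy⟩
    exact hirr ⟨y, hy⟩
  -- The minimal polynomial of an algebraic integer has integer coefficients; here the linear one is
  -- `-2q`.
  rw [minpoly.isIntegrallyClosed_eq_field_fractions' ℚ h] at heq
  have hc := congrArg (fun p => Polynomial.coeff p 1) heq
  simp only [f, Polynomial.coeff_add, Polynomial.coeff_X_pow, Polynomial.coeff_C_mul,
    Polynomial.coeff_X_one, Polynomial.coeff_C, Polynomial.coeff_map] at hc
  refine ⟨-(minpoly ℤ x).coeff 1, ?_⟩
  push_cast
  simp at hc
  linarith

/-- Write `c = num * den / den²` and extract the largest square from `num * den`. -/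
theorem exists_eq_rat_mul_sqrt {δ : ℝ} (hδ : 0 < δ) {c : ℚ} (h : δ ^ 2 = c) :
    ∃ (Δ : ℕ) (ρ : ℚ), Squarefree Δ ∧ δ = ρ * √(Δ : ℝ) := by
  have hc : 0 < c := by
    have : (0 : ℝ) < c := h ▸ pow_pos hδ 2
    exact_mod_cast this
  obtain ⟨Δ, m, hm, hΔ⟩ := Nat.sq_mul_squarefree (c.num.toNat * c.den)
  refine ⟨Δ, m / c.den, hΔ, ?_⟩
  have hd : (0 : ℝ) < c.den := by exact_mod_cast c.den_pos
  have hs : √(Δ : ℝ) ^ 2 = Δ := Real.sq_sqrt (Nat.cast_nonneg _)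
  have hnum : ((c.num.toNat : ℤ)) = c.num := Int.toNat_of_nonneg (Rat.num_pos.2 hc).le
  have hcq : (c : ℝ) = c.num.toNat / c.den := by
    rw [Rat.cast_def]; congr 1; exact_mod_cast hnum.symm
  have hm' : (m : ℝ) ^ 2 * Δ = c.num.toNat * c.den := by exact_mod_cast hm
  rw [← sq_eq_sq₀ hδ.le (by positivity), h, hcq]
  push_cast
  rw [mul_pow, div_pow, hs]
  field_simp
  linarith

/-- A finite set of algebraic integers with rational first and second power sums, all of whose
differences are integer multiples of one real number, consists of integers or of quadratic integers
in one quadratic field. -/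
theorem exists_quadratic_form_of_commensurable {S : Finset ℝ} {θ₀ θ₁ δ : ℝ} {m : ℝ → ℤ}
    (h0 : θ₀ ∈ S) (h1 : θ₁ ∈ S) (hne : θ₁ ≠ θ₀) (hδ : 0 < δ)
    (hm : ∀ θ ∈ S, θ₀ - θ = m θ * δ) (hint : ∀ θ ∈ S, IsIntegral ℤ θ)
    (hs1 : ∃ q : ℚ, ∑ θ ∈ S, θ = q) (hs2 : ∃ q : ℚ, ∑ θ ∈ S, θ ^ 2 = q) :
    ∃ (Δ : ℕ) (a : ℤ) (b n : ℝ → ℤ), Squarefree Δ ∧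
      ∀ θ ∈ S, θ = ((a : ℝ) + b θ * √(Δ : ℝ)) / 2 ∧ b θ₀ - b θ = 2 * n θ := by
  obtain ⟨Q1, hQ1⟩ := hs1
  obtain ⟨Q2, hQ2⟩ := hs2
  have hd : (S.card : ℚ) ≠ 0 := by exact_mod_cast (Finset.card_pos.2 ⟨_, h0⟩).ne'
  have hdR : (S.card : ℝ) ≠ 0 := by exact_mod_cast hd
  -- The mean of `S` serves as origin: coordinates relative to it are rational multiples of `δ` with
  -- sum zero.
  set q : ℚ := Q1 / S.card with hq
  set M : ℚ := ∑ θ ∈ S, (m θ : ℚ) with hM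
  set r : ℝ → ℚ := fun θ => M / S.card - m θ with hr
  have hsum : S.card * θ₀ - M * δ = Q1 := by
    have : ∑ θ ∈ S, (θ₀ - θ) = ∑ θ ∈ S, m θ * δ := Finset.sum_congr rfl hm
    rw [Finset.sum_sub_distrib, hQ1, ← Finset.sum_mul, Finset.sum_const, nsmul_eq_mul] at this
    rw [hM]; push_cast; linarith
  have hθ : ∀ θ ∈ S, θ = q + r θ * δ := by
    intro θ h
    have := hm θ h
    simp only [hq, hr]
    push_cast
    field_simp
    linear_combination -(S.card : ℝ) * this + hsum
  have hr0 : ∑ θ ∈ S, r θ = 0 := by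
    simp only [hr]
    rw [Finset.sum_sub_distrib, Finset.sum_const, nsmul_eq_mul, ← hM]
    field_simp; ring
  have hr01 : r θ₁ ≠ r θ₀ := by
    intro h
    apply hne
    rw [hθ _ h0, hθ _ h1, h]
  have hpos : 0 < ∑ θ ∈ S, r θ ^ 2 := by
    have hex : ∃ θ ∈ S, r θ ≠ 0 := by
      by_contra! hcon
      exact hr01 (by rw [hcon _ h0, hcon _ h1])
    obtain ⟨θ, hθS, hθr⟩ := hex
    exact Finset.sum_pos' (fun _ _ => sq_nonneg _) ⟨θ, hθS, by positivity⟩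
  -- In the second power sum the cross term vanishes because `∑ r = 0`, leaving `Q2 = |S| q² + δ² ∑
  -- r²`.
  have hδ2 : δ ^ 2 = ((Q2 - S.card * q ^ 2) / ∑ θ ∈ S, r θ ^ 2 : ℚ) := by
    have hposR : (0 : ℝ) < ((∑ θ ∈ S, r θ ^ 2 : ℚ) : ℝ) := by exact_mod_cast hpos
    have e1 : ∑ θ ∈ S, θ ^ 2 = ∑ θ ∈ S, ((q : ℝ) ^ 2 + 2 * q * δ * r θ + δ ^ 2 * (r θ : ℝ) ^ 2) :=
      Finset.sum_congr rfl fun θ h => by nth_rewrite 1 [hθ θ h]; ring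
    have hr0R : ∑ θ ∈ S, (r θ : ℝ) = 0 := by exact_mod_cast hr0
    rw [Finset.sum_add_distrib, Finset.sum_add_distrib, ← Finset.mul_sum, ← Finset.mul_sum, hr0R,
      Finset.sum_const, nsmul_eq_mul, hQ2] at e1
    rw [Rat.cast_div, eq_div_iff hposR.ne']
    push_cast
    linarith
  obtain ⟨Δ, ρ, hΔ, hρ⟩ := exists_eq_rat_mul_sqrt hδ hδ2
  have hρ0 : ρ ≠ 0 := by
    rintro rfl
    rw [hρ] at hδ; simp at hδ
  have hΔ0 : 0 < Δ := Nat.pos_of_ne_zero hΔ.ne_zero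
  have hsq : √(Δ : ℝ) ^ 2 = Δ := Real.sq_sqrt (Nat.cast_nonneg _)
  have hform : ∀ θ ∈ S, θ = q + ((r θ * ρ : ℚ) : ℝ) * √(Δ : ℝ) := by
    intro θ h
    nth_rewrite 1 [hθ θ h]
    rw [hρ]; push_cast; ring
  have integral_of : ∀ (x : ℚ), IsIntegral ℤ ((x : ℝ) * √(Δ : ℝ)) → ∃ n : ℤ, x = n := by
    intro x hx
    have h := hx.pow 2
    rw [mul_pow, hsq, show (x : ℝ) ^ 2 * (Δ : ℝ) = ((x ^ 2 * Δ : ℚ) : ℝ) by push_cast; ring] at h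
    obtain ⟨N, hN⟩ := Rat.exists_int_of_isIntegral_real h
    exact hΔ.exists_int_of_sq_mul_eq hN
  -- Differences are integer, not just half-integer, multiples of `√Δ`; this makes `b θ₀ - b θ`
  -- even.
  have hdiff : ∀ θ ∈ S, ∃ n : ℤ, (r θ₀ - r θ) * ρ = n := by
    intro θ h
    apply integral_of
    have e : (((r θ₀ - r θ) * ρ : ℚ) : ℝ) * √(Δ : ℝ) = θ₀ - θ := by
      have e4 := hform _ h0
      have e5 := hform _ h
      push_cast at e4 e5 ⊢
      linarith
    rw [e]
    exact (hint _ h0).sub (hint _ h)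
  have hab : ∃ a : ℤ, ∀ θ ∈ S, ∃ b : ℤ, θ = ((a : ℝ) + b * √(Δ : ℝ)) / 2 := by
    rcases (show Δ = 1 ∨ 2 ≤ Δ by omega) with rfl | h2
    -- For `Δ = 1` the elements are integers `z`, written as `(0 + 2z)/2`.
    · refine ⟨0, fun θ h => ?_⟩
      have e := hform θ h
      rw [Nat.cast_one, Real.sqrt_one, mul_one] at e
      obtain ⟨z, hz⟩ := Rat.exists_int_of_isIntegral_real (q := q + r θ * ρ) (by
        have h' := hint θ h
        rw [e] at h'
        push_cast at h' ⊢
        exact h')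
      have hz' : ((q + r θ * ρ : ℚ) : ℝ) = z := by rw [hz]; norm_cast
      refine ⟨2 * z, ?_⟩
      rw [Nat.cast_one, Real.sqrt_one, mul_one]
      push_cast at e hz' ⊢
      linarith
    · have hex : ∃ θ ∈ S, r θ * ρ ≠ 0 := by
        by_contra! hcon
        exact hr01 (mul_right_cancel₀ hρ0 ((hcon _ h1).trans (hcon _ h0).symm))
      obtain ⟨θ', hθ', hr'⟩ := hex
      obtain ⟨a, ha⟩ := hΔ.exists_int_of_isIntegral_add_mul_sqrt h2 hr' (hform θ' hθ' ▸ hint θ' hθ')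
      have haR : 2 * (q : ℝ) = a := by exact_mod_cast congrArg (Rat.cast : ℚ → ℝ) ha
      refine ⟨a, fun θ h => ?_⟩
      have e := hform θ h
      obtain ⟨b, hb⟩ := integral_of (2 * (r θ * ρ)) (by
        have e' : ((2 * (r θ * ρ) : ℚ) : ℝ) * √(Δ : ℝ) = (2 : ℤ) * θ - a := by
          push_cast at e haR ⊢
          linarith
        rw [e']
        exact ((isIntegral_algebraMap (R := ℤ) (A := ℝ) (x := 2)).mul (hint θ h)).sub
          (isIntegral_algebraMap (R := ℤ) (A := ℝ) (x := a)))
      have hbR : ((2 * (r θ * ρ) : ℚ) : ℝ) = b := by rw [hb]; norm_cast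
      refine ⟨b, ?_⟩
      rw [← haR, ← hbR]
      push_cast at e ⊢
      linarith
  obtain ⟨a, hab⟩ := hab
  choose! b hb using hab
  choose! n hn using hdiff
  refine ⟨Δ, a, b, n, hΔ, fun θ h => ⟨hb θ h, ?_⟩⟩
  have e1 := hb _ h0
  have e2 := hb _ h
  have e3 : ((b θ₀ - b θ : ℤ) : ℝ) * √(Δ : ℝ) = (2 * n θ : ℤ) * √(Δ : ℝ) := by
    have e4 := hform _ h0
    have e5 := hform _ h
    have e6 : (((r θ₀ - r θ) * ρ : ℚ) : ℝ) = n θ := by rw [hn θ h]; norm_cast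
    push_cast at e4 e5 e6 ⊢
    rw [← e6]
    linear_combination -2 * e1 + 2 * e2 + 2 * e4 - 2 * e5
  have hsp : √(Δ : ℝ) ≠ 0 := by positivity
  exact_mod_cast mul_right_cancel₀ hsp e3

/-! ### The sign at the largest eigenvalue, and the obstruction modulo 2. -/

section Graph

variable {V : Type*} [Fintype V] [DecidableEq V] (G : SimpleGraph V) [DecidableRel G.Adj]

theorem adjMatrix_add_smul_one_pow_nonneg {c : ℝ} (hc : 0 ≤ c) (n : ℕ) (v w : V) :
    0 ≤ ((G.adjMatrix ℝ + c • 1) ^ n) v w := by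
  induction n generalizing v w with
  | zero => rw [pow_zero, one_apply]; split_ifs <;> norm_num
  | succ n ih =>
    rw [pow_succ, mul_apply]
    refine Finset.sum_nonneg fun x _ => mul_nonneg (ih v x) ?_
    rw [Matrix.add_apply, Matrix.smul_apply, SimpleGraph.adjMatrix_apply, one_apply, smul_eq_mul]
    split_ifs <;> simp [hc, add_nonneg]

/-- The sign attached to the largest eigenvalue in the support is positive. -/
theorem sign_eq_one_of_isGreatest {i j : V} {θ₀ : ℝ} (hθ₀ : IsGreatest (eigenvalueSupport G i) θ₀)
    {σ : ℝ} (hσ : σ = 1 ∨ σ = -1)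
    (hij : ∀ u : V → ℝ, G.adjMatrix ℝ *ᵥ u = θ₀ • u → u i = σ * u j) : σ = 1 := by
  have hs : (G.adjMatrix ℝ).IsSymm := G.isSymm_adjMatrix
  have hH : (G.adjMatrix ℝ).IsHermitian := by
    rw [IsHermitian, conjTranspose_eq_transpose_of_trivial]; exact hs
  set b : V → V → ℝ := fun k => (hH.eigenvectorBasis k).ofLp with hb
  set l := hH.eigenvalues with hl
  have hbl : ∀ k, G.adjMatrix ℝ *ᵥ b k = l k • b k := fun k => hH.mulVec_eigenvectorBasis k
  have hexpand : ∀ (w : V → ℝ) (v : V), w v = ∑ k, (b k ⬝ᵥ w) * b k v := by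
    intro w v
    have h := congrArg (fun x : EuclideanSpace ℝ V => x v)
      (hH.eigenvectorBasis.sum_repr (WithLp.toLp 2 w))
    simp only [OrthonormalBasis.repr_apply_apply, EuclideanSpace.inner_eq_star_dotProduct,
      star_trivial, WithLp.ofLp_sum, Finset.sum_apply, WithLp.ofLp_smul, Pi.smul_apply,
      smul_eq_mul] at h
    rw [← h]
    exact Finset.sum_congr rfl fun k _ => by rw [dotProduct_comm]
  -- This shift makes all eigenvalues positive, so no negative eigenvalue can compete in absolute
  -- value with `θ₀ + c`.
  set c : ℝ := ∑ k, |l k| + 1 with hc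
  have hlc : ∀ k, 0 < l k + c := fun k => by
    have := Finset.single_le_sum (f := fun k => |l k|) (fun _ _ => abs_nonneg _)
      (Finset.mem_univ k)
    have := neg_abs_le (l k)
    simp only at *; linarith
  have hc0 : 0 ≤ c := add_nonneg (Finset.sum_nonneg fun _ _ => abs_nonneg _) zero_le_one
  obtain ⟨k₀, hk₀, hk₀i⟩ : ∃ k, l k = θ₀ ∧ b k i ≠ 0 := by
    obtain ⟨u, hu, hi⟩ := (mem_eigenvalueSupport_iff G).1 hθ₀.1
    rw [hexpand u i] at hi
    obtain ⟨k, _, hk⟩ := Finset.exists_ne_zero_of_sum_ne_zero hi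
    refine ⟨k, ?_, right_ne_zero_of_mul hk⟩
    have h1 := hs.dotProduct_aeval_mulVec (hbl k) Polynomial.X u
    rw [Polynomial.aeval_X, Polynomial.eval_X, hu, dotProduct_smul, smul_eq_mul] at h1
    exact (mul_right_cancel₀ (left_ne_zero_of_mul hk) h1).symm
  have hpos : 0 < θ₀ + c := hk₀ ▸ hlc k₀
  have hnonneg : ∀ n : ℕ, 0 ≤ ∑ k, ((l k + c) / (θ₀ + c)) ^ n * (b k i * b k j) := by
    intro n
    have h1 := adjMatrix_add_smul_one_pow_nonneg G hc0 n j i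
    have h2 : Polynomial.aeval (G.adjMatrix ℝ) ((Polynomial.X + Polynomial.C c) ^ n) =
        (G.adjMatrix ℝ + c • 1) ^ n := by
      rw [map_pow, map_add, Polynomial.aeval_X, Polynomial.aeval_C, Algebra.algebraMap_eq_smul_one]
    have h3 := hexpand (Polynomial.aeval (G.adjMatrix ℝ)
      ((Polynomial.X + Polynomial.C c) ^ n) *ᵥ Pi.single i 1) j
    simp only [hs.dotProduct_aeval_mulVec (hbl _), dotProduct_single, mul_one,
      Polynomial.eval_pow, Polynomial.eval_add, Polynomial.eval_X, Polynomial.eval_C] at h3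
    rw [h2, mulVec_single_one, col_apply] at h3
    have h4 : ∑ k, ((l k + c) / (θ₀ + c)) ^ n * (b k i * b k j) =
        ((G.adjMatrix ℝ + c • 1) ^ n) j i / (θ₀ + c) ^ n := by
      rw [h3, Finset.sum_div]
      exact Finset.sum_congr rfl fun k _ => by rw [div_pow]; ring
    rw [h4]; positivity
  -- The limit is `(E_{θ₀})_{i,j}`. Eigenvalues above `θ₀` lie outside the support, so their terms
  -- vanish; no connectedness is involved.
  have hlim : Filter.Tendsto (fun n : ℕ => ∑ k, ((l k + c) / (θ₀ + c)) ^ n * (b k i * b k j))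
      Filter.atTop (nhds (∑ k, if l k = θ₀ then b k i * b k j else 0)) := by
    refine tendsto_finsetSum _ fun k _ => ?_
    split_ifs with h
    · rw [h, div_self hpos.ne']; simp
    · by_cases hi : b k i = 0
      · simp [hi]
      · have hle : l k ≤ θ₀ := hθ₀.2 ((mem_eigenvalueSupport_iff G).2 ⟨_, hbl k, hi⟩)
        have hlt : (l k + c) / (θ₀ + c) < 1 := by
          rw [div_lt_one hpos]; linarith [lt_of_le_of_ne hle h]
        simpa using (tendsto_pow_atTop_nhds_zero_of_lt_one (div_pos (hlc k) hpos).le hlt).mul_const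
          (b k i * b k j)
  have hge := ge_of_tendsto' hlim hnonneg
  refine hσ.resolve_right fun hneg => ?_
  have hlt : ∑ k, (if l k = θ₀ then b k i * b k j else 0) < ∑ _k : V, (0 : ℝ) := by
    have hterm : ∀ k, l k = θ₀ → b k i * b k j = -(b k i) ^ 2 := fun k hk => by
      have := hij (b k) (hk ▸ hbl k)
      rw [hneg] at this
      rw [show b k j = - b k i by linarith]; ring
    refine Finset.sum_lt_sum (fun k _ => ?_) ⟨k₀, Finset.mem_univ _, ?_⟩
    · split_ifs with h
      · rw [hterm k h]; linarith [sq_nonneg (b k i)]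
      · exact le_rfl
    · rw [if_pos hk₀, hterm k₀ hk₀]
      exact neg_lt_zero.2 (by positivity)
  rw [Finset.sum_const_zero] at hlt
  linarith

theorem aeval_adjMatrix_mulVec_intCast {R : Type*} [CommRing R] (p : Polynomial ℤ) (x : V → ℤ) :
    (fun v => (((Polynomial.aeval (G.adjMatrix ℤ) p *ᵥ x) v : ℤ) : R)) =
      Polynomial.aeval (G.adjMatrix R) (p.map (Int.castRingHom R)) *ᵥ fun v => (x v : R) := by
  have h : (Int.castRingHom R).mapMatrix (Polynomial.aeval (G.adjMatrix ℤ) p) =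
      Polynomial.aeval (G.adjMatrix R) (p.map (Int.castRingHom R)) := by
    rw [Polynomial.aeval_def, Polynomial.hom_eval₂, Polynomial.aeval_def, Polynomial.eval₂_map,
      adjMatrix_map]
    congr 1
    exact RingHom.ext_int _ _
  funext v
  rw [← h]
  exact RingHom.map_mulVec (Int.castRingHom R) _ _ _

/-- The eigenvalues in the support are not separated by parity according to their signs. -/
theorem false_of_sign_eq_parity {i j : V} (hij : i ≠ j) {σ z : ℝ → ℤ} {z₀ : ℤ}
    (hσ : ∀ θ, σ θ = 1 ∨ σ θ = -1)
    (hcosp : ∀ (θ : ℝ) (u : V → ℝ), G.adjMatrix ℝ *ᵥ u = θ • u → u i = σ θ * u j)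
    (hz : ∀ θ ∈ eigenvalueSupport G i, θ = z θ)
    (hpar : ∀ θ ∈ eigenvalueSupport G i, z₀ - z θ ≡ (1 - σ θ) / 2 [ZMOD 2]) : False := by
  classical
  have hs : (G.adjMatrix ℝ).IsSymm := G.isSymm_adjMatrix
  set S := (finite_eigenvalueSupport G i).toFinset with hS
  -- `e_i + ε e_j` has components only in eigenspaces of support eigenvalues with sign `ε`, which
  -- are exactly the roots of `P ε`.
  let P : ℤ → Polynomial ℤ := fun ε =>
    ∏ θ ∈ S.filter (fun θ => σ θ = ε), (Polynomial.X - Polynomial.C (z θ))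
  have hkill : ∀ ε : ℤ, ε = 1 ∨ ε = -1 → Polynomial.aeval (G.adjMatrix ℤ) (P ε) *ᵥ
      (Pi.single i 1 + Pi.single j ε) = 0 := by
    intro ε hε
    have h0 : (fun v => (((Polynomial.aeval (G.adjMatrix ℤ) (P ε) *ᵥ
        (Pi.single i 1 + Pi.single j ε)) v : ℤ) : ℝ)) = 0 := by
      rw [aeval_adjMatrix_mulVec_intCast]
      refine hs.eq_zero_of_forall_eigenvector fun θ u hu => ?_
      rw [hs.dotProduct_aeval_mulVec hu]
      have hx : (fun v => (((Pi.single i 1 + Pi.single j ε : V → ℤ) v : ℤ) : ℝ)) =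
          Pi.single i 1 + Pi.single j (ε : ℝ) := by
        funext v
        simp only [Pi.add_apply, Pi.single_apply]
        push_cast
        rfl
      rw [hx, dotProduct_add, dotProduct_single, dotProduct_single, mul_one, hcosp θ u hu]
      by_cases hθ : θ ∈ eigenvalueSupport G i
      · by_cases hσε : σ θ = ε
        · rw [Polynomial.eval_map, Polynomial.eval₂_finsetProd]
          rw [Finset.prod_eq_zero (i := θ) (by simp [hS, hθ, hσε]), zero_mul]
          rw [Polynomial.eval₂_sub, Polynomial.eval₂_X, Polynomial.eval₂_C, eq_intCast, sub_eq_zero]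
          exact hz θ hθ
        · have : (σ θ : ℝ) = -ε := by
            have : σ θ = -ε := by have := hσ θ; omega
            exact_mod_cast this
          rw [this]; ring
      · have hi : u i = 0 := by
          by_contra hi
          exact hθ ((mem_eigenvalueSupport_iff G).2 ⟨u, hu, hi⟩)
        have hj : u j = 0 := by
          have := hcosp θ u hu
          rw [hi] at this
          have hne : (σ θ : ℝ) ≠ 0 := by rcases hσ θ with h | h <;> rw [h] <;> norm_num
          exact (mul_eq_zero.1 this.symm).resolve_left hne
        rw [hj]; ring
    funext v
    exact Int.cast_eq_zero.1 (congrFun h0 v)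
  have hmod : ∀ ε : ℤ, ε = 1 ∨ ε = -1 → Polynomial.aeval (G.adjMatrix (ZMod 2))
      ((P ε).map (Int.castRingHom (ZMod 2))) *ᵥ (Pi.single i 1 + Pi.single j 1) = 0 := by
    intro ε hε
    have h := aeval_adjMatrix_mulVec_intCast G (R := ZMod 2) (P ε) (Pi.single i 1 + Pi.single j ε)
    rw [hkill ε hε] at h
    have hε1 : (ε : ZMod 2) = 1 := by rcases hε with rfl | rfl <;> decide
    have hx : (fun v => (((Pi.single i 1 + Pi.single j ε : V → ℤ) v : ℤ) : ZMod 2)) =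
        Pi.single i 1 + Pi.single j 1 := by
      funext v
      simp only [Pi.add_apply, Pi.single_apply]
      push_cast
      rw [hε1]
    rw [hx] at h
    rw [← h]
    funext v; simp
  -- Roots from opposite sign classes have opposite parity, so they differ by a unit of `ZMod 2`.
  have hcop : IsCoprime ((P 1).map (Int.castRingHom (ZMod 2)))
      ((P (-1)).map (Int.castRingHom (ZMod 2))) := by
    simp only [P, Polynomial.map_prod, Polynomial.map_sub, Polynomial.map_X, Polynomial.map_C]
    refine IsCoprime.prod_left fun θ hθ => IsCoprime.prod_right fun θ' hθ' => ?_
    apply Polynomial.isCoprime_X_sub_C_of_isUnit_sub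
    simp only [Finset.mem_filter, hS, Set.Finite.mem_toFinset] at hθ hθ'
    have h1 := hpar θ hθ.1
    have h2 := hpar θ' hθ'.1
    rw [hθ.2] at h1
    rw [hθ'.2] at h2
    norm_num at h1 h2
    rw [← map_sub, eq_intCast]
    have h3 : z θ - z θ' ≡ 1 [ZMOD 2] := by
      have := h2.sub h1
      simpa using this
    rw [(ZMod.intCast_eq_intCast_iff _ _ _).2 h3]
    simp
  -- Applying the Bézout identity to `e_i + e_j`, killed by both polynomials, gives `e_i + e_j = 0`.
  obtain ⟨α, β, hαβ⟩ := hcop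
  have h1 := congrArg (fun p => Polynomial.aeval (G.adjMatrix (ZMod 2)) p *ᵥ
    (Pi.single i 1 + Pi.single j 1 : V → ZMod 2)) hαβ
  simp only [map_add, map_mul, add_mulVec, ← mulVec_mulVec, hmod 1 (Or.inl rfl),
    hmod (-1) (Or.inr rfl), mulVec_zero, map_one, one_mulVec, add_zero] at h1
  have h2 := congrFun h1 i
  simp [hij] at h2

end Graph

/-! ### Phases, signs and parities. -/

theorem Complex.exp_I_mul_eq_sign_iff {x : ℝ} {σ : ℤ} (hσ : σ = 1 ∨ σ = -1) :
    Complex.exp (Complex.I * x) = σ ↔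
      ∃ m : ℤ, x = m * Real.pi ∧ m ≡ (1 - σ) / 2 [ZMOD 2] := by
  have hev : ∀ y : ℝ, Complex.exp (Complex.I * y) = 1 ↔ ∃ n : ℤ, y = n * (2 * Real.pi) := by
    intro y
    rw [Complex.exp_eq_one_iff]
    refine exists_congr fun n => ?_
    rw [show (n : ℂ) * (2 * Real.pi * Complex.I) = Complex.I * ((n * (2 * Real.pi) : ℝ) : ℂ) by
      push_cast; ring, mul_right_inj' Complex.I_ne_zero, Complex.ofReal_inj]
  rcases hσ with rfl | rfl
  · rw [Int.cast_one, hev]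
    constructor
    · rintro ⟨n, hn⟩
      exact ⟨2 * n, by rw [hn]; push_cast; ring, by simp [Int.ModEq]⟩
    · rintro ⟨m, hm, hm2⟩
      have : m % 2 = 0 := by simpa [Int.ModEq] using hm2
      obtain ⟨n, rfl⟩ := Int.dvd_of_emod_eq_zero this
      exact ⟨n, by rw [hm]; push_cast; ring⟩
  · have : Complex.exp (Complex.I * x) = ((-1 : ℤ) : ℂ) ↔
        Complex.exp (Complex.I * ((x - Real.pi : ℝ) : ℂ)) = 1 := by
      push_cast
      rw [mul_sub, Complex.exp_sub, mul_comm _ (Real.pi : ℂ), Complex.exp_pi_mul_I, div_neg,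
        div_one, neg_eq_iff_eq_neg]
    rw [this, hev]
    constructor
    · rintro ⟨n, hn⟩
      exact ⟨2 * n + 1, by push_cast; linarith, by simp [Int.ModEq]⟩
    · rintro ⟨m, hm, hm2⟩
      have : m % 2 = 1 := by simpa [Int.ModEq] using hm2
      refine ⟨m / 2, ?_⟩
      have h2 : m = 2 * (m / 2) + 1 := by omega
      have h3 : (m : ℝ) = 2 * ((m / 2 : ℤ) : ℝ) + 1 := by exact_mod_cast h2
      rw [hm]; nth_rewrite 1 [h3]; ring

section Graph

variable {V : Type*} [Fintype V] [DecidableEq V] (G : SimpleGraph V) [DecidableRel G.Adj]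

theorem PerfectStateTransfer.exists_sign {i j : V} {s : ℝ} (h : PerfectStateTransfer G i j s) :
    ∃ (σ : ℝ → ℤ) (c : ℂ), c ≠ 0 ∧ (∀ θ, σ θ = 1 ∨ σ θ = -1) ∧
      (∀ (θ : ℝ) (u : V → ℝ), G.adjMatrix ℝ *ᵥ u = θ • u → u i = σ θ * u j) ∧
      ∀ θ ∈ eigenvalueSupport G i, Complex.exp (Complex.I * s * θ) * σ θ = c := by
  obtain ⟨c, hc, h⟩ := (perfectStateTransfer_iff G).1 h
  have hc0 : c ≠ 0 := by rintro rfl; simp at hc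
  have key : ∀ θ : ℝ, ∃ σ : ℤ, (σ = 1 ∨ σ = -1) ∧
      (∀ u : V → ℝ, G.adjMatrix ℝ *ᵥ u = θ • u → u i = σ * u j) ∧
      (θ ∈ eigenvalueSupport G i → Complex.exp (Complex.I * s * θ) * σ = c) := by
    intro θ
    have habs : ∀ u : V → ℝ, G.adjMatrix ℝ *ᵥ u = θ • u → |u i| = |u j| := by
      intro u hu
      have h1 := congrArg norm (h θ u hu)
      rw [norm_mul, norm_mul, hc, show Complex.I * s * θ = ((s * θ : ℝ) : ℂ) * Complex.I by
        push_cast; ring, Complex.norm_exp_ofReal_mul_I, one_mul, one_mul] at h1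
      simpa using h1
    by_cases hθ : θ ∈ eigenvalueSupport G i
    · obtain ⟨w, hw, hwi⟩ := (mem_eigenvalueSupport_iff G).1 hθ
      have hwj : w j ≠ 0 := by
        rw [← abs_ne_zero, ← habs w hw, abs_ne_zero]; exact hwi
      obtain ⟨σ, hσ, hwσ⟩ : ∃ σ : ℤ, (σ = 1 ∨ σ = -1) ∧ w i = σ * w j := by
        rcases abs_eq_abs.1 (habs w hw) with h1 | h1
        · exact ⟨1, Or.inl rfl, by simp [h1]⟩
        · exact ⟨-1, Or.inr rfl, by simp [h1]⟩
      have hexp : Complex.exp (Complex.I * s * θ) * σ = c := by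
        have h1 := h θ w hw
        rw [hwσ] at h1
        push_cast at h1
        rw [← mul_assoc] at h1
        exact mul_right_cancel₀ (Complex.ofReal_ne_zero.2 hwj) h1
      refine ⟨σ, hσ, fun u hu => ?_, fun _ => hexp⟩
      have h1 := h θ u hu
      rw [← hexp, mul_assoc (Complex.exp _)] at h1
      exact_mod_cast mul_left_cancel₀ (Complex.exp_ne_zero _) h1
    -- Off the support both entries vanish, so any sign would do.
    · refine ⟨1, Or.inl rfl, fun u hu => ?_, fun h => absurd h hθ⟩
      have hi : u i = 0 := by
        by_contra hi
        exact hθ ((mem_eigenvalueSupport_iff G).2 ⟨u, hu, hi⟩)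
      have hj := habs u hu
      rw [hi, abs_zero] at hj
      rw [hi, abs_eq_zero.1 hj.symm, mul_zero]
  choose σ h1 h2 h3 using key
  exact ⟨σ, c, hc0, h1, h2, h3⟩

/-- The phase condition satisfied by the support at a time of perfect state transfer. -/
theorem PerfectStateTransfer.exists_phase {i j : V} {s θ₀ : ℝ} (h : PerfectStateTransfer G i j s)
    (hθ₀ : IsGreatest (eigenvalueSupport G i) θ₀) :
    ∃ σ : ℝ → ℤ, (∀ θ, σ θ = 1 ∨ σ θ = -1) ∧
      (∀ (θ : ℝ) (u : V → ℝ), G.adjMatrix ℝ *ᵥ u = θ • u → u i = σ θ * u j) ∧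
      ∀ θ ∈ eigenvalueSupport G i, ∃ m : ℤ,
        s * (θ₀ - θ) = m * Real.pi ∧ m ≡ (1 - σ θ) / 2 [ZMOD 2] := by
  obtain ⟨σ, c, hc, hσ, hcosp, hexp⟩ := h.exists_sign G
  refine ⟨σ, hσ, hcosp, fun θ hθ => (Complex.exp_I_mul_eq_sign_iff (hσ θ)).1 ?_⟩
  have h0 : (σ θ₀ : ℝ) = 1 := sign_eq_one_of_isGreatest G hθ₀ (by exact_mod_cast hσ θ₀) (hcosp θ₀)
  have e0 := hexp θ₀ hθ₀.1
  have h0' : (σ θ₀ : ℂ) = 1 := by exact_mod_cast h0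
  rw [h0', mul_one] at e0
  have e1 := hexp θ hθ
  rw [← e0] at e1
  push_cast
  rw [show Complex.I * (s * (θ₀ - θ)) = Complex.I * s * θ₀ - Complex.I * s * θ by ring,
    Complex.exp_sub, ← e1, mul_div_cancel_left₀ _ (Complex.exp_ne_zero _)]

theorem perfectStateTransfer_of_phase {i j : V} {s θ₀ : ℝ} {σ : ℝ → ℤ}
    (hσ : ∀ θ, σ θ = 1 ∨ σ θ = -1)
    (hcosp : ∀ (θ : ℝ) (u : V → ℝ), G.adjMatrix ℝ *ᵥ u = θ • u → u i = σ θ * u j)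
    (hphase : ∀ θ ∈ eigenvalueSupport G i, ∃ m : ℤ,
      s * (θ₀ - θ) = m * Real.pi ∧ m ≡ (1 - σ θ) / 2 [ZMOD 2]) :
    PerfectStateTransfer G i j s := by
  refine (perfectStateTransfer_iff G).2 ⟨Complex.exp (Complex.I * s * θ₀), ?_, fun θ u hu => ?_⟩
  · rw [show Complex.I * s * θ₀ = ((s * θ₀ : ℝ) : ℂ) * Complex.I by push_cast; ring,
      Complex.norm_exp_ofReal_mul_I]
  · by_cases hi : u i = 0
    · have := hcosp θ u hu
      have hj : u j = 0 := by
        rw [hi] at this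
        rcases hσ θ with h | h <;> simp_all
      simp [hi, hj]
    · have h1 := (Complex.exp_I_mul_eq_sign_iff (hσ θ)).2
        (hphase θ ((mem_eigenvalueSupport_iff G).2 ⟨u, hu, hi⟩))
      rw [hcosp θ u hu, show Complex.I * s * θ₀ =
        Complex.I * s * θ + Complex.I * ((s * (θ₀ - θ) : ℝ) : ℂ) by push_cast; ring,
        Complex.exp_add, h1]
      push_cast; ring

/-- If every sign on the support were `+1`, then `e_i - e_j` would be orthogonal to all
eigenvectors. The negative sign supplies a second support eigenvalue and an odd phase multiple. -/
theorem exists_sign_eq_neg_one {i j : V} (hij : i ≠ j) {σ : ℝ → ℤ}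
    (hσ : ∀ θ, σ θ = 1 ∨ σ θ = -1)
    (hcosp : ∀ (θ : ℝ) (u : V → ℝ), G.adjMatrix ℝ *ᵥ u = θ • u → u i = σ θ * u j) :
    ∃ θ ∈ eigenvalueSupport G i, σ θ = -1 := by
  by_contra! hcon
  have h : (Pi.single i 1 - Pi.single j 1 : V → ℝ) = 0 := by
    refine (show (G.adjMatrix ℝ).IsSymm from G.isSymm_adjMatrix).eq_zero_of_forall_eigenvector
      fun θ u hu => ?_
    rw [dotProduct_sub, dotProduct_single, dotProduct_single, mul_one, mul_one, sub_eq_zero]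
    have hu' := hcosp θ u hu
    by_cases hi : u i = 0
    · rw [hi] at hu'
      rcases hσ θ with h | h <;> simp_all
    · rw [(hσ θ).resolve_right (hcon θ ((mem_eigenvalueSupport_iff G).2 ⟨u, hu, hi⟩))] at hu'
      simpa using hu'
  have := congrFun h i
  simp [hij] at this

/-! ### The parameters and the minimum time. -/

theorem exists_transferParameters {i j : V} (hij : i ≠ j) {s : ℝ} (hs : 0 < s)
    (hpst : PerfectStateTransfer G i j s) :
    ∃ Δ g : ℕ, IsTransferParameters G i j Δ g ∧
      IsLeast {t : ℝ | 0 < t ∧ PerfectStateTransfer G i j t} (Real.pi / ((g : ℝ) * √(Δ : ℝ))) := by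
  obtain ⟨σ', _, _, hσ', hcosp', _⟩ := hpst.exists_sign G
  obtain ⟨θ', hθ', _⟩ := exists_sign_eq_neg_one G hij hσ' hcosp'
  obtain ⟨θ₀, hθ₀⟩ : ∃ θ₀, IsGreatest (eigenvalueSupport G i) θ₀ := by
    obtain ⟨θ₀, h1, h2⟩ := (finite_eigenvalueSupport G i).exists_maximal ⟨θ', hθ'⟩
    exact ⟨θ₀, h1, fun θ hθ => (le_total θ θ₀).elim id (h2 hθ)⟩
  obtain ⟨σ, hσ, hcosp, hphase⟩ := hpst.exists_phase G hθ₀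
  have hσ₀ : σ θ₀ = 1 := by
    exact_mod_cast sign_eq_one_of_isGreatest G hθ₀ (σ := σ θ₀) (by exact_mod_cast hσ θ₀)
      (hcosp θ₀)
  obtain ⟨θ₁, hθ₁, hσ₁⟩ := exists_sign_eq_neg_one G hij hσ hcosp
  have hne : θ₁ ≠ θ₀ := by rintro rfl; omega
  choose! m hm hmpar using hphase
  obtain ⟨p, hp⟩ := exists_rat_polynomial_of_eigenvalueSupport G i
  obtain ⟨hs1, hs2⟩ := Polynomial.exists_rat_power_sums hp
  have hmem : ∀ θ, θ ∈ (finite_eigenvalueSupport G i).toFinset ↔ θ ∈ eigenvalueSupport G i :=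
    fun θ => Set.Finite.mem_toFinset _
  -- The common unit of the differences is `δ = π / s`.
  obtain ⟨Δ, a, b, n, hΔ, hform⟩ := exists_quadratic_form_of_commensurable
    ((hmem θ₀).2 hθ₀.1) ((hmem θ₁).2 hθ₁) hne (div_pos Real.pi_pos hs) (m := m)
    (fun θ hθ => by
      have := hm θ ((hmem θ).1 hθ)
      field_simp; linarith)
    (fun θ hθ => isIntegral_of_mem_eigenvalueSupport G ((hmem θ).1 hθ)) hs1 hs2
  simp only [hmem] at hform
  have hΔ0 : 0 < √(Δ : ℝ) := Real.sqrt_pos.2 (by exact_mod_cast Nat.pos_of_ne_zero hΔ.ne_zero)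
  have hdiff : ∀ θ ∈ eigenvalueSupport G i, θ₀ - θ = n θ * √(Δ : ℝ) := by
    intro θ hθ
    have e1 := (hform θ hθ).1
    have e0 := (hform θ₀ hθ₀.1).1
    have e2 : (b θ₀ : ℝ) - b θ = 2 * n θ := by exact_mod_cast (hform θ hθ).2
    linear_combination e0 - e1 + √(Δ : ℝ) / 2 * e2
  -- The gcd of the `n θ` is obtained as a generator of the subgroup they span. Being in the span,
  -- it inherits the phase condition in `hmult`.
  obtain ⟨g', hg'⟩ := Int.subgroup_cyclic (AddSubgroup.closure (n '' eigenvalueSupport G i))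
  set g : ℕ := g'.natAbs with hg
  have hdvd : ∀ θ ∈ eigenvalueSupport G i, ∃ k : ℤ, n θ = g * k := by
    intro θ hθ
    have h1 : n θ ∈ AddSubgroup.closure (n '' eigenvalueSupport G i) :=
      AddSubgroup.subset_closure ⟨θ, hθ, rfl⟩
    rw [hg', AddSubgroup.mem_closure_singleton] at h1
    obtain ⟨k, hk⟩ := h1
    have h2 : (g : ℤ) ∣ n θ := by
      rw [hg, Int.natAbs_dvd]; exact ⟨k, by rw [← hk, smul_eq_mul, mul_comm]⟩
    exact h2
  choose! k hk using hdvd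
  have hgpos : 0 < g := by
    refine Nat.pos_of_ne_zero fun h0 => hne ?_
    have h1 := hdiff θ₁ hθ₁
    rw [hk θ₁ hθ₁, h0] at h1
    push_cast at h1
    linarith
  have hgR : (0 : ℝ) < g := by exact_mod_cast hgpos
  have hmult : ∀ t : ℝ, (∀ θ ∈ eigenvalueSupport G i, ∃ m : ℤ, t * (θ₀ - θ) = m * Real.pi) →
      ∃ N : ℤ, t * (g * √(Δ : ℝ)) = N * Real.pi := by
    intro t ht
    have h1 : ∀ x ∈ AddSubgroup.closure (n '' eigenvalueSupport G i),
        ∃ N : ℤ, t * ((x : ℝ) * √(Δ : ℝ)) = N * Real.pi := by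
      intro x hx
      induction hx using AddSubgroup.closure_induction with
      | mem x hx =>
        obtain ⟨θ, hθ, rfl⟩ := hx
        rw [← hdiff θ hθ]; exact ht θ hθ
      | zero => exact ⟨0, by simp⟩
      | add x y _ _ hx hy =>
        obtain ⟨N, hN⟩ := hx
        obtain ⟨N', hN'⟩ := hy
        exact ⟨N + N', by push_cast; linear_combination hN + hN'⟩
      | neg x _ hx =>
        obtain ⟨N, hN⟩ := hx
        exact ⟨-N, by push_cast; linear_combination -hN⟩
    have h2 : (g : ℤ) ∈ AddSubgroup.closure (n '' eigenvalueSupport G i) := by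
      have h3 : g' ∈ AddSubgroup.closure (n '' eigenvalueSupport G i) := by
        rw [hg']; exact AddSubgroup.subset_closure rfl
      rcases Int.natAbs_eq g' with h4 | h4
      · rw [hg, ← h4]; exact h3
      · rw [hg, ← neg_eq_iff_eq_neg.2 h4]; exact neg_mem h3
    exact_mod_cast h1 _ h2
  obtain ⟨N, hN⟩ := hmult s fun θ hθ => ⟨m θ, hm θ hθ⟩
  have hmk : ∀ θ ∈ eigenvalueSupport G i, m θ = N * k θ := by
    intro θ hθ
    have h1 := hm θ hθ
    rw [hdiff θ hθ, hk θ hθ] at h1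
    push_cast at h1
    have h2 : ((m θ : ℤ) : ℝ) * Real.pi = ((N * k θ : ℤ) : ℝ) * Real.pi := by
      push_cast
      linear_combination -h1 + (k θ : ℝ) * hN
    exact_mod_cast mul_right_cancel₀ Real.pi_ne_zero h2
  -- At `θ₁` the sign is `-1`, so `m θ₁ = N * k θ₁` is odd. With `N` odd, each `k θ` has the parity
  -- of `m θ`.
  have hNodd : N % 2 = 1 := by
    have h1 := hmpar θ₁ hθ₁
    rw [hσ₁, hmk θ₁ hθ₁] at h1
    have h2 : N * k θ₁ % 2 = 1 := by simpa [Int.ModEq] using h1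
    exact Int.odd_iff.1 (Int.odd_mul.1 (Int.odd_iff.2 h2)).1
  have hkpar : ∀ θ ∈ eigenvalueSupport G i, k θ ≡ (1 - σ θ) / 2 [ZMOD 2] := by
    intro θ hθ
    have h1 := hmpar θ hθ
    rw [hmk θ hθ] at h1
    have h2 : N ≡ 1 [ZMOD 2] := by simpa [Int.ModEq] using hNodd
    have h3 := h2.mul_right (k θ)
    rw [one_mul] at h3
    exact h3.symm.trans h1
  refine ⟨Δ, g, ⟨hΔ, hgpos, a, b, σ, θ₀, hθ₀,
    fun θ => ⟨hσ θ, (eigenprojection_single_eq_iff G).2 (hcosp θ)⟩,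
    fun θ hθ => (hform θ hθ).1,
    fun θ hθ => ⟨k θ, by rw [(hform θ hθ).2, hk θ hθ]; ring, hkpar θ hθ⟩⟩, ⟨by positivity, ?_⟩, ?_⟩
  · refine perfectStateTransfer_of_phase G hσ hcosp (θ₀ := θ₀) fun θ hθ => ⟨k θ, ?_, hkpar θ hθ⟩
    rw [hdiff θ hθ, hk θ hθ]
    push_cast
    field_simp
  · rintro t ⟨ht0, ht⟩
    obtain ⟨_, _, _, hph⟩ := ht.exists_phase G hθ₀
    obtain ⟨N', hN'⟩ := hmult t fun θ hθ => (hph θ hθ).imp fun _ h => h.1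
    have h1 : (0 : ℝ) < N' := by
      by_contra! hle
      have h2 : 0 < t * (g * √(Δ : ℝ)) := by positivity
      rw [hN'] at h2
      nlinarith [Real.pi_pos]
    have h2 : (1 : ℝ) ≤ N' := by exact_mod_cast Int.add_one_le_iff.2 (by exact_mod_cast h1 : 0 < N')
    rw [div_le_iff₀ (by positivity), hN']
    nlinarith [Real.pi_pos]

theorem IsTransferParameters.two_le_or_two_le {i j : V} (hij : i ≠ j) {Δ g : ℕ}
    (h : IsTransferParameters G i j Δ g) : 2 ≤ g ∨ 2 ≤ Δ := by
  obtain ⟨hΔ, hg, a, b, σ, θ₀, hθ₀, hσ, hform, hk⟩ := h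
  by_contra! hcon
  obtain rfl : g = 1 := by omega
  obtain rfl : Δ = 1 := by have := Nat.pos_of_ne_zero hΔ.ne_zero; omega
  simp only [Nat.cast_one, Real.sqrt_one, mul_one] at hform hk
  have hint : ∀ θ ∈ eigenvalueSupport G i, ∃ z : ℤ, θ = z := by
    intro θ hθ
    have h1 := isIntegral_of_mem_eigenvalueSupport G hθ
    -- A rational algebraic integer is an integer.
    have h2 : θ = (((a + b θ) / 2 : ℚ) : ℝ) := by push_cast; exact hform θ hθ
    rw [h2] at h1
    obtain ⟨z, hz⟩ := Rat.exists_int_of_isIntegral_real h1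
    exact ⟨z, by rw [h2, hz]; norm_cast⟩
  choose! z hz using hint
  refine false_of_sign_eq_parity G hij (z₀ := z θ₀) (fun θ => (hσ θ).1)
    (fun θ => (eigenprojection_single_eq_iff G).1 (hσ θ).2) hz fun θ hθ => ?_
  obtain ⟨k, hk1, hk2⟩ := hk θ hθ
  have h1 : ((z θ₀ - z θ : ℤ) : ℝ) = k := by
    have e1 : (b θ₀ : ℝ) - b θ = 2 * k := by exact_mod_cast hk1
    push_cast
    rw [← hz θ hθ, ← hz θ₀ hθ₀.1]
    linear_combination hform θ₀ hθ₀.1 - hform θ hθ + e1 / 2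
  rwa [show z θ₀ - z θ = k by exact_mod_cast h1]

end Graph

theorem mainTheorem4 {V : Type*} [Fintype V] [DecidableEq V] (G : SimpleGraph V)
    [DecidableRel G.Adj] (i j : V) (hij : i ≠ j)
    (hpst : ∃ s : ℝ, 0 < s ∧ PerfectStateTransfer G i j s) :
    ∃ t : ℝ, IsLeast {s : ℝ | 0 < s ∧ PerfectStateTransfer G i j s} t ∧
      t ≤ Real.pi / √2 ∧
      (∃ Δ g : ℕ, IsTransferParameters G i j Δ g ∧ t = Real.pi / ((g : ℝ) * √(Δ : ℝ))) ∧
      (∀ Δ g : ℕ, IsTransferParameters G i j Δ g → 2 ≤ g ∨ 2 ≤ Δ) := by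
  obtain ⟨s, hs, hpst⟩ := hpst
  obtain ⟨Δ, g, hpar, hleast⟩ := exists_transferParameters G hij hs hpst
  refine ⟨_, hleast, ?_, ⟨Δ, g, hpar, rfl⟩, fun Δ g h => h.two_le_or_two_le G hij⟩
  have hΔ : (1 : ℝ) ≤ Δ := by exact_mod_cast Nat.pos_of_ne_zero hpar.1.ne_zero
  have hg : (1 : ℝ) ≤ g := by exact_mod_cast hpar.2.1
  have hsΔ : 1 ≤ √(Δ : ℝ) := Real.one_le_sqrt.2 hΔ
  -- What remains is `√2 ≤ g√Δ`, where both factors are at least 1 and `g ≥ 2` or `Δ ≥ 2`.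
  refine div_le_div_of_nonneg_left Real.pi_pos.le (by positivity) ?_
  rcases hpar.two_le_or_two_le G hij with h | h
  · have h2 : (2 : ℝ) ≤ g := by exact_mod_cast h
    have h3 : √(2 : ℝ) ≤ 2 := by
      rw [Real.sqrt_le_left (by norm_num)]; norm_num
    nlinarith
  · have h2 : √(2 : ℝ) ≤ √(Δ : ℝ) := Real.sqrt_le_sqrt (by exact_mod_cast h)
    nlinarith [Real.sqrt_nonneg (2 : ℝ)]
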